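/- Let $R$ be a commutative ring with identity, let $n\ge 1$ be an integer, let $M_n(R)$ be the ring of $n\times n$ matrices over $R$, and let $J(R)$ be the Jacobson radical of $R$. A ring $S$ is called nil-clean if for every $a\in S$ there is an idempotent $e\in S$ such that $a-e$ is nilpotent; a ring is called Boolean if each of its elements is idempotent; an ideal is called nil if each of its elements is nilpotent. Then the following are equivalent: (1) $M_n(R)$ is nil-clean; (2) $R/J(R)$ is Boolean and $J(R)$ is nil; (3) for every $a\in R$, the element $a-a^2$ is nilpotent. -/

import Mathlib

/-- An element `a` of a ring is nil-clean if there is an idempotent `e` such that `a - e` is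
nilpotent. -/
def IsNilCleanElem {R : Type*} [Ring R] (a : R) : Prop :=
  ∃ e : R, IsIdempotentElem e ∧ IsNilpotent (a - e)

/-- A ring is nil-clean if each of its elements is nil-clean. -/
def IsNilCleanRing (R : Type*) [Ring R] : Prop :=
  ∀ a : R, IsNilCleanElem a

/-- A ring is Boolean if each of its elements is idempotent: the property asserted by Mathlib's
class `BooleanRing`, stated for a given ring structure. -/
def IsBooleanRing (R : Type*) [Ring R] : Prop :=
  ∀ a : R, IsIdempotentElem a

/-- An ideal is nil if each of its elements is nilpotent. -/
def IsNilIdeal {R : Type*} [Ring R] (I : Ideal R) : Prop :=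
  ∀ a ∈ I, IsNilpotent a

open Module

/-! The substance is 3 → 1. Under 3 every quotient by a prime is `ZMod 2`, so homomorphisms to `ZMod
2` detect nilpotency, of elements and, through characteristic polynomials, of matrices. The entries
of an idempotent chosen over `ZMod 2` are functions of the entries of the given matrix, so
polynomials interpolate them over `R`; the result is idempotent modulo the nilradical and lifts
(`isNilCleanElem_matrix`).

Over `ZMod 2`, invariant subspaces reduce the claim to a cyclic endomorphism, where, small cases
aside, subtracting a nilpotent shift leaves an idempotent (`isNilCleanElem_of_cyclic`). For 1 → 3,
scalar matrices suffice. -/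

/-! ### Endomorphisms over the field with two elements -/

theorem exists_isNilpotent_shift {F V : Type*} [Field F] [AddCommGroup V] [Module F V]
    [FiniteDimensional F V] (w : ℕ → V)
    (hw : Submodule.span F (w '' Set.Iio (finrank F V)) = ⊤) :
    ∃ N : End F V, IsNilpotent N ∧ (∀ i, i + 1 < finrank F V → N (w i) = w (i + 1)) ∧
      ∀ i, i + 1 = finrank F V → N (w i) = 0 := by
  set n := finrank F V with hn
  have hspan : ⊤ ≤ Submodule.span F (Set.range fun i : Fin n ↦ w i) := by
    rw [← hw]
    apply Submodule.span_mono
    rintro _ ⟨i, hi, rfl⟩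
    exact ⟨⟨i, hi⟩, rfl⟩
  let b : Basis (Fin n) F V := basisOfTopLeSpanOfCardEqFinrank _ hspan (by simp [hn])
  have hb (i : Fin n) : b i = w i := by simp [b]
  -- Extension by zero makes the shift rule hold at every index.
  let w' : ℕ → V := fun i ↦ if i < n then w i else 0
  let N : End F V := b.constr F fun i : Fin n ↦ w' (i + 1)
  have hN (i : ℕ) (hi : i < n) : N (w i) = w' (i + 1) := by
    have := b.constr_basis F (fun i : Fin n ↦ w' (i + 1)) ⟨i, hi⟩
    rwa [hb] at this
  have hN' (i : ℕ) : N (w' i) = w' (i + 1) := by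
    by_cases hi : i < n
    · simpa [w', hi] using hN i hi
    · have : ¬ i + 1 < n := by omega
      simp [w', hi, this]
  have hpow (k i : ℕ) : (N ^ k) (w' i) = w' (i + k) := by
    induction k with
    | zero => simp
    | succ k ih => rw [pow_succ', Module.End.mul_apply, ih, hN', add_assoc]
  refine ⟨N, ⟨n, b.ext fun i ↦ ?_⟩, fun i hi ↦ ?_, fun i hi ↦ ?_⟩
  · have := hpow n i
    simpa [w', hb] using this
  · simp [hN i (by omega), w', hi]
  · simp [hN i (by omega), w', hi]

theorem isIdempotentElem_of_span {F V : Type*} [Field F] [AddCommGroup V] [Module F V]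
    {s : Set V} (hs : Submodule.span F s = ⊤) {E : End F V}
    (h : ∀ x ∈ s, E (E x) = E x) : IsIdempotentElem E :=
  LinearMap.ext_on hs h

/-- In the basis `(A ^ i) v` this is a companion matrix, of trace `c m`. If the trace is 1,
subtracting the shift along this basis leaves an idempotent of rank one. If it is 0, changing the
last basis vector to `l` leaves one of rank two. -/
theorem isNilCleanElem_of_cyclic {V : Type*} [AddCommGroup V] [Module (ZMod 2) V]
    [FiniteDimensional (ZMod 2) V] (A : End (ZMod 2) V) (v : V) (c : ℕ → ZMod 2)
    (hc : A ^ finrank (ZMod 2) V = ∑ i ∈ Finset.range (finrank (ZMod 2) V), c i • A ^ i)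
    (hv : Submodule.span (ZMod 2) ((fun i ↦ (A ^ i) v) '' Set.Iio (finrank (ZMod 2) V)) = ⊤) :
    IsNilCleanElem A := by
  have hA (i : ℕ) : A ((A ^ i) v) = (A ^ (i + 1)) v := by rw [pow_succ', Module.End.mul_apply]
  have h01 (x : ZMod 2) : x = 0 ∨ x = 1 := by revert x; decide
  have hadd (x : V) : x + x = 0 := by rw [← two_smul (ZMod 2) x]; exact zero_smul _ x
  have hsub (x y : V) : x - y = x + y := by rw [sub_eq_iff_eq_add, add_assoc, hadd, add_zero]
  obtain hn | ⟨m, hn⟩ : finrank (ZMod 2) V = 0 ∨ ∃ m, finrank (ZMod 2) V = m + 1 := by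
    cases finrank (ZMod 2) V <;> simp
  · have := (finrank_zero_iff (R := ZMod 2)).1 hn
    exact ⟨0, .zero, 1, LinearMap.ext fun x ↦ Subsingleton.elim _ _⟩
  obtain h | h := h01 (c m)
  -- The modified basis involves three powers of `A`, so dimensions 1 and 2 are separate.
  · obtain rfl | rfl | ⟨k, rfl⟩ : m = 0 ∨ m = 1 ∨ ∃ k, m = k + 2 := by
      rcases m with _ | _ | m <;> simp
    · exact ⟨0, .zero, 1, by simpa [hn, h] using hc⟩
    · have hA2 : A ^ 2 = c 0 • 1 := by simpa [hn, h, Finset.sum_range_succ] using hc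
      obtain h0 | h0 := h01 (c 0)
      · exact ⟨0, .zero, 2, by simpa [h0] using hA2⟩
      · refine ⟨1, .one, 2, ?_⟩
        have h2 : (A - 1) ^ 2 = A ^ 2 - (A + A) + 1 := by noncomm_ring
        rw [h2, hA2, h0, one_smul]
        ext x
        simp [hadd]
    · simp only [hn] at hc hv
      -- With this `β`, `A l` and `l` have the same coefficient at `(A ^ (k + 1)) v`, so `A - N`
      -- moves `l` by a vector that it kills.
      set β : ZMod 2 := 1 + c (k + 1) with hβ
      set l : V := (A ^ (k + 2)) v + (A ^ (k + 1)) v + β • (A ^ k) v with hl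
      let w : ℕ → V := fun i ↦ if i = k + 2 then l else (A ^ i) v
      have hwl : w (k + 2) = l := by simp [w]
      have hwi (i : ℕ) (hi : i < k + 2) : w i = (A ^ i) v := by simp [w, hi.ne]
      have hw : Submodule.span (ZMod 2) (w '' Set.Iio (k + 2 + 1)) = ⊤ := by
        rw [← top_le_iff, ← hv, Submodule.span_le]
        have hmem (i : ℕ) (hi : i < k + 2) :
            (A ^ i) v ∈ Submodule.span (ZMod 2) (w '' Set.Iio (k + 2 + 1)) :=
          Submodule.subset_span ⟨i, hi.trans (Nat.lt_succ_self _), hwi i hi⟩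
        rintro _ ⟨i, hi, rfl⟩
        obtain hi | rfl : i < k + 2 ∨ i = k + 2 := by simp at hi; omega
        · exact hmem i hi
        · have : (A ^ (k + 2)) v = w (k + 2) - (A ^ (k + 1)) v - β • (A ^ k) v := by
            rw [hwl, hl]; abel
          simp only [this]
          exact sub_mem (sub_mem (Submodule.subset_span ⟨k + 2, by simp, rfl⟩)
            (hmem _ (by omega))) (Submodule.smul_mem _ _ (hmem _ (by omega)))
      obtain ⟨N, hN, hN1, hN2⟩ := exists_isNilpotent_shift w (by rw [hn]; exact hw)
      rw [hn] at hN1 hN2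
      have hE0 (i : ℕ) (hi : i < k + 1) : (A - N) ((A ^ i) v) = 0 := by
        rw [LinearMap.sub_apply, hA, ← hwi i (by omega), hN1 i (by omega), hwi _ (by omega),
          sub_self]
      have hE1 : (A - N) ((A ^ (k + 1)) v) = (A ^ (k + 1)) v + β • (A ^ k) v := by
        rw [LinearMap.sub_apply, hA, ← hwi (k + 1) (by omega), hN1 _ (by omega), hwl, hl,
          hwi _ (by omega), hsub]
        linear_combination (norm := module) hadd ((A ^ (k + 2)) v)
      have hcv : (A ^ (k + 3)) v =
          ∑ i ∈ Finset.range (k + 1), c i • (A ^ i) v + c (k + 1) • (A ^ (k + 1)) v := by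
        have := congrArg (fun f : End (ZMod 2) V ↦ f v) hc
        simpa [Finset.sum_range_succ _ (k + 2), Finset.sum_range_succ _ (k + 1), h,
          LinearMap.sum_apply] using this
      have hE2 : (A - N) l = l + (∑ i ∈ Finset.range (k + 1), c i • (A ^ i) v +
          β • (A ^ k) v) := by
        have h1 : N l = 0 := by rw [← hwl]; exact hN2 _ rfl
        rw [LinearMap.sub_apply, h1, sub_zero, hl]
        simp only [map_add, map_smul, hA, hcv, hβ]
        simp only [add_smul, one_smul]
        have e1 := hadd ((A ^ (k + 1)) v)
        have e2 := hadd (c (k + 1) • (A ^ (k + 1)) v)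
        have e3 := hadd ((A ^ k) v)
        have e4 := hadd (c (k + 1) • (A ^ k) v)
        linear_combination (norm := module) e2 - e3 - e4
      have hu : (A - N) (∑ i ∈ Finset.range (k + 1), c i • (A ^ i) v + β • (A ^ k) v) = 0 := by
        rw [map_add, map_sum, map_smul, hE0 k (by omega), smul_zero, add_zero]
        refine Finset.sum_eq_zero fun i hi ↦ ?_
        rw [map_smul, hE0 i (by simpa using hi), smul_zero]
      refine ⟨A - N, isIdempotentElem_of_span hw ?_, by simpa using hN⟩
      rintro _ ⟨i, hi, rfl⟩
      obtain hi | rfl | rfl : i < k + 1 ∨ i = k + 1 ∨ i = k + 2 := by simp at hi; omega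
      · rw [hwi i (by omega), hE0 i hi, map_zero]
      · rw [hwi _ (by omega), hE1, map_add, map_smul, hE0 k (by omega), smul_zero, add_zero, hE1]
      · rw [hwl, hE2, map_add _ l, hE2, hu, add_zero]
  · obtain ⟨N, hN, hN1, hN2⟩ := exists_isNilpotent_shift (fun i ↦ (A ^ i) v) hv
    rw [hn] at hN1 hN2 hc hv
    have hE0 (i : ℕ) (hi : i < m) : (A - N) ((A ^ i) v) = 0 := by
      rw [LinearMap.sub_apply, hA, hN1 i (by omega), sub_self]
    have hE1 : (A - N) ((A ^ m) v) =
        ∑ i ∈ Finset.range m, c i • (A ^ i) v + (A ^ m) v := by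
      have := congrArg (fun f : End (ZMod 2) V ↦ f v) hc
      rw [LinearMap.sub_apply, hA, hN2 m rfl, sub_zero]
      simpa [Finset.sum_range_succ, h, LinearMap.sum_apply] using this
    refine ⟨A - N, isIdempotentElem_of_span hv ?_, by simpa using hN⟩
    rintro _ ⟨i, hi, rfl⟩
    obtain hi | rfl : i < m ∨ i = m := by simp at hi; omega
    · simp only [hE0 i hi, map_zero]
    · simp only
      rw [hE1, map_add, map_sum, hE1, Finset.sum_eq_zero, zero_add]
      intro i hi
      rw [map_smul, hE0 i (by simpa using hi), smul_zero]

/-- `A` is block triangular; subtracting the block diagonal idempotent leaves nilpotent diagonal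
blocks. -/
theorem IsNilCleanElem.of_invariant {F V W Q : Type*} [Field F] [AddCommGroup V] [Module F V]
    [AddCommGroup W] [Module F W] [AddCommGroup Q] [Module F Q] {i : W →ₗ[F] V} {q : V →ₗ[F] Q}
    {p : V →ₗ[F] W} {s : Q →ₗ[F] V} (hpi : ∀ x, p (i x) = x) (hqs : ∀ x, q (s x) = x)
    (hqi : ∀ x, q (i x) = 0) (hps : ∀ x, p (s x) = 0) (hip : ∀ x, i (p x) + s (q x) = x)
    {A : End F V} {A₁ : End F W} {A₂ : End F Q} (h₁ : ∀ x, A (i x) = i (A₁ x))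
    (h₂ : ∀ x, q (A x) = A₂ (q x)) (hA₁ : IsNilCleanElem A₁) (hA₂ : IsNilCleanElem A₂) :
    IsNilCleanElem A := by
  obtain ⟨E₁, hE₁, k₁, hk₁⟩ := hA₁
  obtain ⟨E₂, hE₂, k₂, hk₂⟩ := hA₂
  have hE₁' (x : W) : E₁ (E₁ x) = E₁ x := LinearMap.congr_fun hE₁ x
  have hE₂' (x : Q) : E₂ (E₂ x) = E₂ x := LinearMap.congr_fun hE₂ x
  let E : End F V := i ∘ₗ E₁ ∘ₗ p + s ∘ₗ E₂ ∘ₗ q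
  have hE (x : V) : E x = i (E₁ (p x)) + s (E₂ (q x)) := rfl
  have hNi (k : ℕ) (x : W) : ((A - E) ^ k) (i x) = i (((A₁ - E₁) ^ k) x) := by
    induction k with
    | zero => simp
    | succ k ih => simp [pow_succ', ih, hE, hpi, hqi, h₁]
  have hqN (k : ℕ) (x : V) : q (((A - E) ^ k) x) = ((A₂ - E₂) ^ k) (q x) := by
    induction k with
    | zero => simp
    | succ k ih => simp [pow_succ', ← ih, hE, hqs, hqi, h₂]
  refine ⟨E, LinearMap.ext fun x ↦ ?_, k₁ + k₂, LinearMap.ext fun x ↦ ?_⟩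
  · simp [hE, hpi, hqs, hqi, hps, hE₁', hE₂']
  · have hq : q (((A - E) ^ k₂) x) = 0 := by simp [hqN, hk₂]
    have := hip (((A - E) ^ k₂) x)
    rw [hq, map_zero, add_zero] at this
    rw [pow_add, Module.End.mul_apply, ← this, hNi, hk₁]
    simp

theorem LinearMap.exists_pow_finrank_eq_sum {F V : Type*} [Field F] [AddCommGroup V] [Module F V]
    [FiniteDimensional F V] (A : End F V) :
    ∃ c : ℕ → F, A ^ finrank F V = ∑ i ∈ Finset.range (finrank F V), c i • A ^ i := by
  refine ⟨fun i ↦ -A.charpoly.coeff i, ?_⟩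
  have h := A.aeval_self_charpoly
  rw [A.charpoly_monic.as_sum, A.charpoly_natDegree] at h
  simp only [map_add, map_pow, Polynomial.aeval_X, map_sum, map_mul, Polynomial.aeval_C] at h
  rw [eq_neg_of_add_eq_zero_left h, ← Finset.sum_neg_distrib]
  simp [Algebra.smul_def]

/-- By Cayley–Hamilton the span is already invariant under `A`. -/
theorem span_pow_apply_eq_top {F V : Type*} [Field F] [AddCommGroup V] [Module F V]
    [FiniteDimensional F V] {A : End F V} {v : V} (hv : v ≠ 0)
    (hA : ∀ W : Submodule F V, W ≤ W.comap A → W ≠ ⊥ → W = ⊤) :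
    Submodule.span F ((fun i ↦ (A ^ i) v) '' Set.Iio (finrank F V)) = ⊤ := by
  set n := finrank F V with hn
  have : Nontrivial V := ⟨v, 0, hv⟩
  have hpos : 0 < n := finrank_pos
  obtain ⟨c, hc⟩ := A.exists_pow_finrank_eq_sum
  have hmem (i : ℕ) (hi : i < n) :
      (A ^ i) v ∈ Submodule.span F ((fun i ↦ (A ^ i) v) '' Set.Iio n) :=
    Submodule.subset_span ⟨i, hi, rfl⟩
  refine hA _ (Submodule.span_le.2 ?_) fun h ↦ hv ?_
  · rintro _ ⟨i, hi, rfl⟩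
    have hs : A ((A ^ i) v) = (A ^ (i + 1)) v := by rw [pow_succ', Module.End.mul_apply]
    simp only [Submodule.comap_coe, Set.mem_preimage, hs, SetLike.mem_coe]
    obtain hi' | hi' := (show i + 1 ≤ n from hi).lt_or_eq
    · exact hmem _ hi'
    · rw [hi', hn, hc, LinearMap.sum_apply]
      exact Submodule.sum_mem _ fun j hj ↦
        Submodule.smul_mem _ _ (hmem j (by simpa using hj))
  · simpa [h] using hmem 0 hpos

theorem isNilCleanElem_end_zmod_two {V : Type*} [AddCommGroup V] [Module (ZMod 2) V]
    [FiniteDimensional (ZMod 2) V] (A : End (ZMod 2) V) : IsNilCleanElem A := by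
  induction hd : finrank (ZMod 2) V using Nat.strong_induction_on generalizing V with
  | _ d ih =>
  by_cases hA : ∀ W : Submodule (ZMod 2) V, W ≤ W.comap A → W ≠ ⊥ → W = ⊤
  · obtain hV | ⟨v, hv⟩ := forall_or_exists_not fun v : V ↦ v = 0
    · exact ⟨0, .zero, 1, LinearMap.ext fun x ↦ hV _⟩
    · obtain ⟨c, hc⟩ := A.exists_pow_finrank_eq_sum
      exact isNilCleanElem_of_cyclic A v c hc (span_pow_apply_eq_top hv hA)
  · push Not at hA
    obtain ⟨W, hW, hbot, htop⟩ := hA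
    obtain ⟨s, hs⟩ := W.mkQ.exists_rightInverse_of_surjective W.range_mkQ
    have hs' (x : V ⧸ W) : W.mkQ (s x) = x := LinearMap.congr_fun hs x
    let p : V →ₗ[ZMod 2] W := (LinearMap.id - s ∘ₗ W.mkQ).codRestrict W fun x ↦ by
      refine (Submodule.Quotient.mk_eq_zero W).1 ?_
      change W.mkQ (x - s (W.mkQ x)) = 0
      rw [map_sub, hs', sub_self]
    have hp (x : V) : (p x : V) = x - s (W.mkQ x) := rfl
    have hq (x : W) : W.mkQ x = 0 := by simp
    have hadd := W.finrank_quotient_add_finrank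
    have hlt := Submodule.finrank_lt htop
    have hpos : 0 < finrank (ZMod 2) W := by
      rw [pos_iff_ne_zero, Ne, Submodule.finrank_eq_zero]
      exact hbot
    refine IsNilCleanElem.of_invariant (i := W.subtype) (q := W.mkQ) (p := p) (s := s)
      (A₁ := A.restrict hW) (A₂ := W.mapQ W A hW) (fun x ↦ Subtype.ext ?_) hs' hq
      (fun x ↦ Subtype.ext ?_) (fun x ↦ ?_) (fun x ↦ rfl) (fun x ↦ rfl)
      (ih _ (by omega) _ rfl) (ih _ (by omega) _ rfl)
    · rw [hp, W.subtype_apply, hq, map_zero, sub_zero]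
    · rw [hp, hs', sub_self]; rfl
    · rw [W.subtype_apply, hp, sub_add_cancel]

theorem isNilCleanElem_matrix_zmod_two {n : Type*} [Fintype n] [DecidableEq n]
    (A : Matrix n n (ZMod 2)) : IsNilCleanElem A := by
  obtain ⟨E, hE, hN⟩ := isNilCleanElem_end_zmod_two (Matrix.toLinAlgEquiv' A)
  refine ⟨Matrix.toLinAlgEquiv'.symm E, hE.map _, ?_⟩
  simpa using hN.map Matrix.toLinAlgEquiv'.symm

/-! ### Passage from `ZMod 2` to `R` -/

/-- Some prime misses `x`; its quotient is a domain in which every element is idempotent, hence 0 or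
1. -/
theorem exists_ringHom_zmod_two_ne_zero {R : Type*} [CommRing R]
    (hR : ∀ a : R, IsNilpotent (a - a ^ 2)) {x : R} (hx : ¬ IsNilpotent x) :
    ∃ ψ : R →+* ZMod 2, ψ x ≠ 0 := by
  obtain ⟨P, hP, hxP⟩ : ∃ P : Ideal R, P.IsPrime ∧ x ∉ P := by
    rw [← mem_nilradical, nilradical_eq_sInf, Submodule.mem_sInf] at hx
    push Not at hx
    exact hx
  have h01 (y : R ⧸ P) : y = 0 ∨ y = 1 := by
    obtain ⟨a, rfl⟩ := Ideal.Quotient.mk_surjective y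
    have h := ((hR a).map (Ideal.Quotient.mk P)).eq_zero
    rw [map_sub, map_pow, sub_eq_zero] at h
    by_cases h0 : Ideal.Quotient.mk P a = 0
    · exact .inl h0
    · refine .inr (mul_left_cancel₀ h0 ?_)
      rw [mul_one, ← sq, ← h]
  have hcard : Nat.card (R ⧸ P) = 2 :=
    Nat.card_eq_two_iff.2 ⟨0, 1, zero_ne_one, Set.eq_univ_of_forall fun y ↦ by simpa using h01 y⟩
  have : Finite (R ⧸ P) := Nat.finite_of_card_ne_zero (by simp [hcard])
  have := Fintype.ofFinite (R ⧸ P)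
  rw [Nat.card_eq_fintype_card] at hcard
  let e := ZMod.ringEquivOfPrime (R ⧸ P) Nat.prime_two hcard
  refine ⟨e.symm.toRingHom.comp (Ideal.Quotient.mk P), fun h ↦ hxP ?_⟩
  rw [← Ideal.Quotient.eq_zero_iff_mem]
  simpa using h

theorem exists_forall_ringHom_zmod_two_apply_eq {R ι : Type*} [CommRing R] [Finite ι]
    (g : (ι → ZMod 2) → ZMod 2) (x : ι → R) :
    ∃ r : R, ∀ ψ : R →+* ZMod 2, ψ r = g (ψ ∘ x) := by
  classical
  have := Fintype.ofFinite ι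
  -- Interpolation: under `ψ` the product becomes the indicator of `a = ψ ∘ x`.
  refine ⟨∑ a : ι → ZMod 2, ((g a).val : R) * ∏ i, if a i = 1 then x i else 1 - x i,
    fun ψ ↦ ?_⟩
  have h2 (a b : ZMod 2) : (if a = 1 then b else 1 - b) = if a = b then 1 else 0 := by
    revert a b; decide
  have hprod (a : ι → ZMod 2) : (∏ i, if a i = 1 then ψ (x i) else 1 - ψ (x i)) =
      if a = ψ ∘ x then 1 else 0 := by
    simp_rw [h2, Finset.prod_ite_zero, funext_iff]
    simp
  simp only [map_sum, map_mul, ZMod.natCast_val, map_prod, apply_ite ψ, map_sub,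
    map_one, hprod]
  simp

/-- The lower coefficients of the characteristic polynomial vanish under every `ψ`, so they are
nilpotent; Cayley–Hamilton then makes a power of `M` nilpotent. -/
theorem Matrix.isNilpotent_of_forall_ringHom {R n : Type*} [CommRing R] [Fintype n]
    [DecidableEq n] (hR : ∀ a : R, IsNilpotent (a - a ^ 2)) {M : Matrix n n R}
    (hM : ∀ ψ : R →+* ZMod 2, IsNilpotent (M.map ψ)) : IsNilpotent M := by
  have h : IsNilpotent (M.charpoly - Polynomial.X ^ Fintype.card n) := by
    rw [Polynomial.isNilpotent_iff]
    intro i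
    by_contra hi
    obtain ⟨ψ, hψ⟩ := exists_ringHom_zmod_two_ne_zero hR hi
    have := (Matrix.isNilpotent_charpoly_sub_pow_of_isNilpotent (hM ψ)).eq_zero
    rw [Matrix.charpoly_map] at this
    have hc := congrArg (fun f ↦ f.coeff i) this
    apply hψ
    simpa [Polynomial.coeff_X_pow, apply_ite ψ] using hc
  have h' := h.map (Polynomial.aeval M)
  rw [map_sub, Matrix.aeval_self_charpoly, zero_sub, isNilpotent_neg_iff, map_pow,
    Polynomial.aeval_X] at h'
  obtain ⟨k, hk⟩ := h'
  exact ⟨_, by rw [← pow_mul] at hk; exact hk⟩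

theorem isNilCleanElem_matrix {R n : Type*} [CommRing R] [Fintype n]
    [DecidableEq n] (hR : ∀ a : R, IsNilpotent (a - a ^ 2)) (A : Matrix n n R) :
    IsNilCleanElem A := by
  choose e he hN using isNilCleanElem_matrix_zmod_two (n := n)
  choose E₀ hE₀ using fun i j ↦ exists_forall_ringHom_zmod_two_apply_eq
    (fun a : n × n → ZMod 2 ↦ e (.of fun i j ↦ a (i, j)) i j) (fun k ↦ A k.1 k.2)
  have hψE₀ (ψ : R →+* ZMod 2) : ψ.mapMatrix (.of E₀) = e (ψ.mapMatrix A) := by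
    ext i j
    exact hE₀ i j ψ
  let f := (Ideal.Quotient.mk (nilradical R)).mapMatrix (m := n)
  have hf (ψ : R →+* ZMod 2) {M N : Matrix n n R} (h : f M = f N) :
      ψ.mapMatrix M = ψ.mapMatrix N := by
    ext i j
    have hij : Ideal.Quotient.mk (nilradical R) (M i j) = Ideal.Quotient.mk _ (N i j) :=
      congrFun₂ h i j
    rw [Ideal.Quotient.eq, mem_nilradical] at hij
    simpa [sub_eq_zero] using (hij.map ψ).eq_zero
  have hker (M) (hM : M ∈ RingHom.ker f) : IsNilpotent M :=
    Matrix.isNilpotent_of_forall_ringHom hR fun ψ ↦ by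
      have : ψ.mapMatrix M = 0 := by
        rw [hf ψ (N := 0) (by rwa [map_zero]), map_zero]
      change IsNilpotent (ψ.mapMatrix M)
      rw [this]
      exact .zero
  have hidem : IsIdempotentElem (f (.of E₀)) := by
    rw [IsIdempotentElem, ← map_mul]
    ext i j
    change Ideal.Quotient.mk (nilradical R) _ = Ideal.Quotient.mk _ _
    rw [Ideal.Quotient.eq, mem_nilradical]
    by_contra hij
    obtain ⟨ψ, hψ⟩ := exists_ringHom_zmod_two_ne_zero hR hij
    apply hψ
    have h : ψ.mapMatrix (.of E₀ * .of E₀) = ψ.mapMatrix (.of E₀) := by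
      rw [map_mul, hψE₀, he]
    rw [map_sub, sub_eq_zero]
    exact congrFun₂ h i j
  -- The lift agrees with `E₀` modulo the nilradical, hence under every `ψ`.
  obtain ⟨E, hE, hfE⟩ := exists_isIdempotentElem_eq_of_ker_isNilpotent f hker _ ⟨_, rfl⟩ hidem
  refine ⟨E, hE, Matrix.isNilpotent_of_forall_ringHom hR fun ψ ↦ ?_⟩
  change IsNilpotent (ψ.mapMatrix (A - E))
  rw [map_sub, hf ψ hfE, hψE₀]
  exact hN _

/-! ### Scalar matrices and the Jacobson radical -/

theorem isNilpotent_sub_sq_of_isNilCleanElem_scalar {R n : Type*} [CommRing R] [Fintype n]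
    [DecidableEq n] [Nonempty n] {a : R} (h : IsNilCleanElem (Matrix.scalar n a)) :
    IsNilpotent (a - a ^ 2) := by
  obtain ⟨E, hE, hN⟩ := h
  have hc : Commute (Matrix.scalar n a) E := Matrix.scalar_commute a (.all a) E
  have hc' : Commute (Matrix.scalar n a - E) (1 - E - Matrix.scalar n a) :=
    (((Commute.one_right _).sub_right hc).sub_right (.refl _)).sub_left
      (((Commute.one_right _).sub_right (.refl _)).sub_right hc.symm)
  -- Both `E` terms cancel because `E` is idempotent and commutes with scalars.
  have key : Matrix.scalar n (a - a ^ 2) =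
      (Matrix.scalar n a - E) * (1 - E - Matrix.scalar n a) := by
    rw [map_sub, map_pow]
    simp only [sub_mul, mul_sub, mul_one, hE.eq, hc.eq]
    noncomm_ring
  have := hc'.isNilpotent_mul_right hN
  rwa [← key, IsNilpotent.map_iff fun _ _ h ↦ Matrix.scalar_inj.1 h] at this

/-- In `a - a ^ 2 = a * (1 - a)` the second factor is a unit. -/
theorem isNilpotent_of_mem_jacobson {R : Type*} [CommRing R] {a : R}
    (ha : IsNilpotent (a - a ^ 2)) (hJ : a ∈ Ring.jacobson R) : IsNilpotent a := by
  rw [← Ideal.jacobson_bot] at hJ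
  obtain ⟨k, hk⟩ := ha
  have hu : IsUnit (a * -1 + 1) := Ideal.mem_jacobson_bot.1 hJ (-1)
  refine ⟨k, ?_⟩
  rwa [show a - a ^ 2 = a * (a * -1 + 1) by ring, mul_pow, (hu.pow k).mul_left_eq_zero] at hk

theorem IsNilpotent.mem_ring_jacobson {R : Type*} [CommRing R] {a : R} (ha : IsNilpotent a) :
    a ∈ Ring.jacobson R := by
  rw [Ring.jacobson_eq_sInf_isMaximal, Submodule.mem_sInf]
  exact fun P hP ↦ nilradical_le_prime P (H := Ideal.IsMaximal.isPrime hP) ha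

theorem corollary2p7 {R : Type*} [CommRing R] (n : ℕ) (hn : 1 ≤ n) :
    List.TFAE [
      IsNilCleanRing (Matrix (Fin n) (Fin n) R),
      IsBooleanRing (R ⧸ Ring.jacobson R) ∧ IsNilIdeal (Ring.jacobson R),
      ∀ a : R, IsNilpotent (a - a ^ 2)] := by
  have : Nonempty (Fin n) := ⟨⟨0, hn⟩⟩
  tfae_have 1 → 3 := fun h a ↦ isNilpotent_sub_sq_of_isNilCleanElem_scalar (h _)
  tfae_have 3 → 1 := isNilCleanElem_matrix
  tfae_have 3 → 2 := by
    refine fun h ↦ ⟨fun x ↦ ?_, fun a ha ↦ isNilpotent_of_mem_jacobson (h a) ha⟩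
    obtain ⟨a, rfl⟩ := Ideal.Quotient.mk_surjective x
    rw [IsIdempotentElem, ← map_mul, ← sq, eq_comm, Ideal.Quotient.eq]
    exact (h a).mem_ring_jacobson
  tfae_have 2 → 3 := by
    refine fun ⟨hB, hJ⟩ a ↦ hJ _ ?_
    rw [← Ideal.Quotient.eq, map_pow, sq]
    exact (hB _).symm
  tfae_finish
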